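/- Let $n,m\ge 0$ be integers and let $A_0,A_1,\dots,A_m\in\mathbb{C}^{n\times n}$. For delays $\tau=(\tau_1,\dots,\tau_m)$ with $\tau_k\ge 0$, consider the linear delay differential equation $$\dot x(t)=A_0x(t)+\sum_{k=1}^m A_k\,x(t-\tau_k),$$ whose characteristic roots are the zeros $\lambda\in\mathbb{C}$ of $$Q_\tau(\lambda)=\det\Big[\lambda I-A_0-\sum_{k=1}^m A_k e^{-\lambda\tau_k}\Big].$$ The equation is called absolutely stable if, for all $\tau_1,\dots,\tau_m\ge 0$, every characteristic root satisfies $\operatorname{Re}\lambda<0$, and absolutely hyperbolic if, for all $\tau_1,\dots,\tau_m\ge 0$, every characteristic root satisfies $\operatorname{Re}\lambda\neq 0$. For $\Phi=(\varphi_1,\dots,\varphi_m)\in\mathbb{T}^m$, where $\mathbb{T}=\mathbb{R}/2\pi\mathbb{Z}$, put $$S(\Phi)=A_0+\sum_{k=1}^m A_k e^{i\varphi_k},$$ and let $\sigma(M)$ denote the spectrum of a matrix $M$. The equation is absolutely stable if and only if the following three conditions hold: (A1.1) $A_0$ is Hurwitz, i.e. $\operatorname{Re}\lambda<0$ for every $\lambda\in\sigma(A_0)$;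 (A1.2) $S(0)=\sum_{k=0}^m A_k$ is nonsingular; (A1.3) $i\omega\notin\sigma(S(\Phi))$ for all $\Phi\in\mathbb{T}^m$ and all real $\omega\neq 0$. Moreover, the equation is absolutely hyperbolic if and only if (A1.2) and (A1.3) hold. -/

import Mathlib

noncomputable section

namespace DelaySystem

/-- The characteristic quasipolynomial
`Q(z) = det (z I - A₀ - ∑ₖ Aₖ exp (-z τₖ))` of the linear delay differential equation
`x'(t) = A₀ x(t) + ∑ₖ Aₖ x(t - τₖ)`. The matrix `Aₖ` and the delay `τₖ`, `k = 1, …, m`, are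
`A (k - 1)` and `τ (k - 1)`. -/
def charQuasipoly {n m : ℕ} (A₀ : Matrix (Fin n) (Fin n) ℂ)
    (A : Fin m → Matrix (Fin n) (Fin n) ℂ) (τ : Fin m → ℝ) (z : ℂ) : ℂ :=
  (z • (1 : Matrix (Fin n) (Fin n) ℂ) - A₀ - ∑ k, Complex.exp (-z * (τ k : ℂ)) • A k).det

/-- All characteristic roots have negative real part, for all nonnegative delays. -/
def AbsolutelyStable {n m : ℕ} (A₀ : Matrix (Fin n) (Fin n) ℂ)
    (A : Fin m → Matrix (Fin n) (Fin n) ℂ) : Prop :=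
  ∀ τ : Fin m → ℝ, (∀ k, 0 ≤ τ k) → ∀ z : ℂ, charQuasipoly A₀ A τ z = 0 → z.re < 0

/-- All characteristic roots have nonzero real part, for all nonnegative delays. -/
def AbsolutelyHyperbolic {n m : ℕ} (A₀ : Matrix (Fin n) (Fin n) ℂ)
    (A : Fin m → Matrix (Fin n) (Fin n) ℂ) : Prop :=
  ∀ τ : Fin m → ℝ, (∀ k, 0 ≤ τ k) → ∀ z : ℂ, charQuasipoly A₀ A τ z = 0 → z.re ≠ 0

/-- A complex square matrix is Hurwitz if its spectrum lies in the open left half-plane. -/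
def IsHurwitz {n : ℕ} (M : Matrix (Fin n) (Fin n) ℂ) : Prop :=
  ∀ z ∈ spectrum ℂ M, z.re < 0

/-- `S(Φ) = A₀ + ∑ₖ Aₖ exp (i φₖ)` for feedback phases `Φ` in the torus `𝕋ᵐ`, where
`𝕋 = ℝ / 2πℤ` is `Real.Angle` and `Real.Angle.toCircle` sends `φ` to `exp (i φ)`. -/
def phaseMatrix {n m : ℕ} (A₀ : Matrix (Fin n) (Fin n) ℂ)
    (A : Fin m → Matrix (Fin n) (Fin n) ℂ) (Φ : Fin m → Real.Angle) :
    Matrix (Fin n) (Fin n) ℂ :=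
  A₀ + ∑ k, ((Φ k).toCircle : ℂ) • A k

end DelaySystem

end

open Metric Set Filter Topology

namespace DelaySystem

/-! With `pencilDet` `P(z, w) = det (z I - A₀ - ∑ wₖ Aₖ)`, characteristic roots solve `P(z, exp (-z
τ)) = 0`. The point `exp (-z τ)` is on the torus if `Re z = 0` and in the closed polydisc if `Re z ≥
0`; `w = 0` gives `A₀`. On the axis, delays realize all phases when `z ≠ 0` and only `w = 1` when `z
= 0`, which settles hyperbolicity.

For stability, absence of nonzero imaginary roots spreads from the torus to the polydisc
(`pencilDet_ne_zero_of_torus_of_ray`). Scaling `w` down to `0` then links the roots to `σ(A₀)`: a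
crossing could only occur at `z = 0`, and `pencilDet_zero_smul_eq_zero` makes such a zero root
persist for every scaling. Conversely, large delays bring characteristic roots close to unstable
eigenvalues of `A₀`. -/

/-! ### Persistence of zeros of entire functions -/

/-- If an entire function vanishes on a neighborhood of a point, then it vanishes identically. -/
lemma eq_zero_of_eventually_eq_zero {f : ℂ → ℂ} (hf : Differentiable ℂ f) {a : ℂ}
    (h : ∀ᶠ z in 𝓝 a, f z = 0) (z : ℂ) : f z = 0 :=
  congrFun (AnalyticOnNhd.eq_of_eventuallyEq (fun z _ => hf.analyticAt z)
    (fun _ _ => analyticAt_const (v := (0 : ℂ))) h) z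

/-- A zero of an entire function which is small at the center of a disc, compared to its variation
on the boundary. -/
lemma exists_zero_of_le_norm_sub {f : ℂ → ℂ} (hf : Differentiable ℂ f) {a : ℂ} {r ε : ℝ}
    (hr : 0 < r) (hε : 0 < ε) (hs : ∀ z ∈ sphere a r, ε ≤ ‖f z - f a‖) (ha : ‖f a‖ < ε / 2) :
    ∃ z ∈ closedBall a r, f z = 0 := by
  have hfr : ∃ᶠ z in 𝓝 a, f z ≠ f a := by
    intro h
    have hz : ∀ᶠ z in 𝓝 a, f z - f a = 0 := by
      filter_upwards [h] with z hz
      simpa [sub_eq_zero] using hz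
    have hp : a + r ∈ sphere a r := by simp [abs_of_pos hr]
    have h1 := hs _ hp
    rw [eq_zero_of_eventually_eq_zero (f := fun z => f z - f a) (hf.sub_const _) hz] at h1
    simp only [norm_zero] at h1
    linarith
  have h0 : (0 : ℂ) ∈ ball (f a) (ε / 2) := by simpa using ha
  -- Quantitative open mapping theorem: the image of the disc contains the ball of radius `ε / 2`
  -- about `f a`.
  exact hf.diffContOnCl.ball_subset_image_closedBall hr hs hfr h0

/-- Persistence of zeros under perturbation, in the style of Hurwitz: if `f y₀` is entire, not
identically zero and vanishes at `a`, then `z ↦ f (g z) z` vanishes somewhere in a given disc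
around `a` as soon as `g` takes values close enough to `y₀` on that disc. -/
lemma exists_nhds_forall_exists_zero {Y : Type*} [TopologicalSpace Y] {f : Y → ℂ → ℂ}
    (hf : Continuous fun p : Y × ℂ => f p.1 p.2) {y₀ : Y} (h₀ : Differentiable ℂ (f y₀)) {a b : ℂ}
    (ha : f y₀ a = 0) (hb : f y₀ b ≠ 0) {δ : ℝ} (hδ : 0 < δ) :
    ∃ U ∈ 𝓝 y₀, ∀ g : ℂ → Y, (∀ z ∈ closedBall a δ, g z ∈ U) →
      Differentiable ℂ (fun z => f (g z) z) → ∃ z ∈ closedBall a δ, f (g z) z = 0 := by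
  have hne : ∀ᶠ z in 𝓝[≠] a, f y₀ z ≠ 0 :=
    (h₀.analyticAt a).eventually_eq_zero_or_eventually_ne_zero.resolve_left
      fun h => hb (eq_zero_of_eventually_eq_zero h₀ h b)
  rw [eventually_nhdsWithin_iff] at hne
  obtain ⟨ρ, hρ, hball⟩ := nhds_basis_closedBall.mem_iff.mp hne
  set r := min ρ δ with hr
  have hr0 : 0 < r := lt_min hρ hδ
  have hsph : ∀ z ∈ sphere a r, f y₀ z ≠ 0 := by
    intro z hz
    refine hball (closedBall_subset_closedBall (min_le_left _ _) (sphere_subset_closedBall hz)) ?_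
    rintro rfl
    simp at hz
    linarith
  obtain ⟨z₁, hz₁, hmin⟩ := (isCompact_sphere a r).exists_isMinOn
    (NormedSpace.sphere_nonempty.mpr hr0.le) h₀.continuous.norm.continuousOn
  set c := ‖f y₀ z₁‖ with hc
  have hc0 : 0 < c := norm_pos_iff.mpr (hsph _ hz₁)
  -- An error below `c / 6` leaves more than `5c / 6` on the sphere and less than `c / 6` at the
  -- center. The variation is thus at least `c / 2`, and `c / 6 < c / 4`.
  have hU : ∀ᶠ y in 𝓝 y₀, ∀ z ∈ closedBall a r, ‖f y z - f y₀ z‖ < c / 6 := by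
    refine (isCompact_closedBall a r).eventually_forall_of_forall_eventually fun z _ => ?_
    have hcont : Continuous fun p : Y × ℂ => ‖f p.1 p.2 - f y₀ p.2‖ :=
      (hf.sub (h₀.continuous.comp continuous_snd)).norm
    exact hcont.continuousAt.eventually_lt_const (by simp; linarith)
  refine ⟨_, hU, fun g hg hd => ?_⟩
  have hsub : closedBall a r ⊆ closedBall a δ := closedBall_subset_closedBall (min_le_right _ _)
  have hclose : ∀ z ∈ closedBall a r, ‖f (g z) z - f y₀ z‖ < c / 6 :=
    fun z hz => hg z (hsub hz) z hz
  have hfa : ‖f (g a) a‖ < c / 6 := by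
    simpa [ha] using hclose a (mem_closedBall_self hr0.le)
  obtain ⟨z, hz, hz0⟩ := exists_zero_of_le_norm_sub hd (a := a) (ε := c / 2) hr0 (by linarith)
    (fun z hz => by
      have h1 : c ≤ ‖f y₀ z‖ := hmin hz
      have h2 := hclose z (sphere_subset_closedBall hz)
      have h3 := norm_sub_norm_le (f y₀ z) (f y₀ z - f (g z) z)
      have h4 := norm_sub_norm_le (f (g z) z) (f (g a) a)
      rw [sub_sub_cancel, norm_sub_rev (f y₀ z)] at h3
      linarith) (by linarith)
  exact ⟨z, hsub hz, hz0⟩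

/-! ### The determinant on the closed polydisc -/

variable {n m : ℕ} (A₀ : Matrix (Fin n) (Fin n) ℂ) (A : Fin m → Matrix (Fin n) (Fin n) ℂ)

/-- The polynomial `det (z I - A₀ - ∑ₖ wₖ Aₖ)` in `z` and `w`. -/
def pencilDet (z : ℂ) (w : Fin m → ℂ) : ℂ :=
  (z • (1 : Matrix (Fin n) (Fin n) ℂ) - A₀ - ∑ k, w k • A k).det

lemma continuous_pencilDet {X : Type*} [TopologicalSpace X] {z : X → ℂ} {w : X → Fin m → ℂ}
    (hz : Continuous z) (hw : Continuous w) : Continuous fun x => pencilDet A₀ A (z x) (w x) := by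
  unfold pencilDet
  fun_prop

lemma differentiable_pencilDet {z : ℂ → ℂ} {w : ℂ → Fin m → ℂ}
    (hz : Differentiable ℂ z) (hw : ∀ k, Differentiable ℂ fun x => w x k) :
    Differentiable ℂ fun x => pencilDet A₀ A (z x) (w x) := by
  unfold pencilDet
  simp only [Matrix.det_apply, Matrix.sub_apply, Matrix.smul_apply, Matrix.sum_apply]
  fun_prop

lemma pencilDet_eq_zero_iff (z : ℂ) (w : Fin m → ℂ) :
    pencilDet A₀ A z w = 0 ↔ z ∈ spectrum ℂ (A₀ + ∑ k, w k • A k) := by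
  rw [spectrum.mem_iff, Matrix.isUnit_iff_isUnit_det, isUnit_iff_ne_zero, not_not,
    Algebra.algebraMap_eq_smul_one, ← sub_sub, pencilDet]

lemma charQuasipoly_eq_pencilDet (τ : Fin m → ℝ) (z : ℂ) :
    charQuasipoly A₀ A τ z = pencilDet A₀ A z fun k => Complex.exp (-z * (τ k : ℂ)) := rfl

lemma pencilDet_zero_right_eq_zero_iff (z : ℂ) :
    pencilDet A₀ A z 0 = 0 ↔ z ∈ spectrum ℂ A₀ := by
  simp [pencilDet_eq_zero_iff]

/-- The closed unit polydisc. -/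
def polydisc (m : ℕ) : Set (Fin m → ℂ) := univ.pi fun _ => closedBall 0 1

lemma mem_polydisc {w : Fin m → ℂ} : w ∈ polydisc m ↔ ∀ k, ‖w k‖ ≤ 1 := by
  simp [polydisc]

lemma isCompact_polydisc : IsCompact (polydisc m) :=
  isCompact_univ_pi fun _ => isCompact_closedBall _ _

lemma smul_mem_polydisc {w : Fin m → ℂ} (hw : w ∈ polydisc m) {t : ℂ} (ht : ‖t‖ ≤ 1) :
    t • w ∈ polydisc m := by
  rw [mem_polydisc] at hw ⊢
  intro k
  simpa using mul_le_one₀ ht (norm_nonneg _) (hw k)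

attribute [local instance] Matrix.linftyOpNormedRing Matrix.linftyOpNormedAlgebra in
/-- The roots `z` are bounded uniformly over the closed polydisc. -/
lemma exists_norm_le_of_pencilDet_eq_zero :
    ∃ R : ℝ, ∀ z, ∀ w ∈ polydisc m, pencilDet A₀ A z w = 0 → ‖z‖ ≤ R := by
  have hcont : Continuous fun w : Fin m → ℂ => A₀ + ∑ k, w k • A k := by fun_prop
  obtain ⟨C, hC⟩ := isCompact_polydisc.exists_bound_of_continuousOn hcont.continuousOn
  -- The factor `‖1‖` is `0` rather than `1` when `n = 0`.
  refine ⟨C * ‖(1 : Matrix (Fin n) (Fin n) ℂ)‖, fun z w hw h => ?_⟩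
  rw [pencilDet_eq_zero_iff] at h
  exact (spectrum.norm_le_norm_mul_of_mem h).trans
    (mul_le_mul_of_nonneg_right (hC w hw) (norm_nonneg _))

lemma exists_pencilDet_ne_zero {w : Fin m → ℂ} (hw : w ∈ polydisc m) :
    ∃ z, pencilDet A₀ A z w ≠ 0 := by
  obtain ⟨R, hR⟩ := exists_norm_le_of_pencilDet_eq_zero A₀ A
  refine ⟨((|R| + 1 : ℝ) : ℂ), fun h => ?_⟩
  have h1 := hR _ w hw h
  rw [Complex.norm_real, Real.norm_of_nonneg (by positivity)] at h1
  linarith [le_abs_self R]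

/-! ### From the torus to the polydisc, and from the axis to the half-plane -/

variable {A₀ A}

/-- If there are no roots on the open ray through `s` for `w` in the torus, then there are none
for `w` in the closed polydisc. -/
lemma pencilDet_ne_zero_of_torus_of_ray {s : ℂ} (hs : ‖s‖ = 1)
    (h : ∀ w : Fin m → ℂ, (∀ k, ‖w k‖ = 1) → ∀ ω : ℝ, 0 < ω → pencilDet A₀ A (s * ω) w ≠ 0)
    {w₀ : Fin m → ℂ} (hw₀ : w₀ ∈ polydisc m) {ω₀ : ℝ} (hω₀ : 0 < ω₀) :
    pencilDet A₀ A (s * ω₀) w₀ ≠ 0 := by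
  intro h0
  obtain ⟨R, hR⟩ := exists_norm_le_of_pencilDet_eq_zero A₀ A
  have hbound : ∀ w ∈ polydisc m, ∀ ω : ℝ, pencilDet A₀ A (s * ω) w = 0 → ω ≤ R := by
    intro w hw ω hω
    have := hR _ w hw hω
    rw [norm_mul, hs, one_mul, Complex.norm_real] at this
    exact (le_abs_self ω).trans this
  have hB : IsCompact ((Icc ω₀ R ×ˢ polydisc m) ∩
      {p : ℝ × (Fin m → ℂ) | pencilDet A₀ A (s * p.1) p.2 = 0}) :=
    (isCompact_Icc.prod isCompact_polydisc).inter_right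
      (isClosed_eq (continuous_pencilDet A₀ A (by fun_prop) (by fun_prop)) continuous_const)
  obtain ⟨⟨ω₁, w₁⟩, ⟨⟨⟨hω₁, -⟩, hw₁⟩, h1⟩, hmax⟩ := hB.exists_isMaxOn
    ⟨(ω₀, w₀), ⟨⟨⟨le_rfl, hbound w₀ hw₀ ω₀ h0⟩, hw₀⟩, h0⟩⟩ continuous_fst.continuousOn
  simp only at hω₁ hw₁
  replace h1 : pencilDet A₀ A (s * ω₁) w₁ = 0 := h1
  have hgt : ∀ w ∈ polydisc m, ∀ ω : ℝ, ω₁ < ω → pencilDet A₀ A (s * ω) w ≠ 0 := by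
    intro w hw ω hω hz
    have : ω ≤ ω₁ := hmax (show (ω, w) ∈ _ from
      ⟨⟨⟨hω₁.trans hω.le, hbound w hw ω hz⟩, hw⟩, hz⟩)
    linarith
  -- Coordinates of a root with maximal `ω` can be moved to the unit circle one at a time.
  have key : ∀ S : Finset (Fin m), ∃ w ∈ polydisc m, (∀ k ∈ S, ‖w k‖ = 1) ∧
      pencilDet A₀ A (s * ω₁) w = 0 := by
    intro S
    induction S using Finset.induction_on with
    | empty => exact ⟨w₁, hw₁, by simp, h1⟩
    | insert j S hj ih =>
      obtain ⟨w, hw, hwS, hwz⟩ := ih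
      have hwk := mem_polydisc.mp hw
      have hupd : ∀ t : ℂ, ‖t‖ ≤ 1 → Function.update w j t ∈ polydisc m := by
        intro t ht
        rw [mem_polydisc]
        intro k
        rcases eq_or_ne k j with rfl | hk
        · simpa using ht
        · simpa [hk] using hwk k
      have hdiff : ∀ z : ℂ,
          Differentiable ℂ fun t => pencilDet A₀ A z (Function.update w j t) := by
        intro z
        refine differentiable_pencilDet A₀ A (by fun_prop) fun k => ?_
        rcases eq_or_ne k j with rfl | hk
        · simp
        · simp [hk]
      rcases (hwk j).lt_or_eq with hlt | heq
      -- If `1` is also a root in the `j`-th coordinate, move there. Otherwise the zero `w j` is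
      -- isolated and survives a slight increase of `ω`, against maximality; the radius `1 - ‖w j‖`
      -- keeps it in the disc.
      · by_cases hall : pencilDet A₀ A (s * ω₁) (Function.update w j 1) = 0
        · refine ⟨_, hupd 1 (by simp), fun k hk => ?_, hall⟩
          rcases eq_or_ne k j with rfl | hkj
          · simp
          · simpa [hkj] using hwS k (Finset.mem_of_mem_insert_of_ne hk hkj)
        · exfalso
          obtain ⟨U, hU, hzero⟩ := exists_nhds_forall_exists_zero
            (f := fun (ω : ℝ) t => pencilDet A₀ A (s * ω) (Function.update w j t))
            (continuous_pencilDet A₀ A (by fun_prop)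
              (continuous_const.update j continuous_snd)) (y₀ := ω₁) (hdiff _)
            (a := w j) (by simpa using hwz) hall (sub_pos.mpr hlt)
          obtain ⟨ω, hωU, hω⟩ := nonempty_of_mem (f := 𝓝[>] ω₁)
            (inter_mem (mem_nhdsWithin_of_mem_nhds hU) self_mem_nhdsWithin)
          obtain ⟨t, ht, htz⟩ := hzero (fun _ => ω) (fun _ _ => hωU) (hdiff _)
          refine hgt _ (hupd t ?_) ω hω htz
          rw [mem_closedBall, dist_eq_norm] at ht
          linarith [norm_le_norm_add_norm_sub (w j) t, norm_sub_rev (w j) t]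
      · refine ⟨w, hw, fun k hk => ?_, hwz⟩
        rcases Finset.mem_insert.mp hk with rfl | hk
        · exact heq
        · exact hwS k hk
  obtain ⟨w, -, hwt, hwz⟩ := key Finset.univ
  exact h w (fun k => hwt k (Finset.mem_univ k)) ω₁ (hω₀.trans_le hω₁) hwz

/-- If there are no nonzero imaginary roots for `w` in the torus, then there are none for `w` in
the closed polydisc. -/
lemma pencilDet_I_mul_ne_zero_of_torus
    (h : ∀ w : Fin m → ℂ, (∀ k, ‖w k‖ = 1) → ∀ ω : ℝ, ω ≠ 0 → pencilDet A₀ A (Complex.I * ω) w ≠ 0)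
    {w : Fin m → ℂ} (hw : w ∈ polydisc m) {ω : ℝ} (hω : ω ≠ 0) :
    pencilDet A₀ A (Complex.I * ω) w ≠ 0 := by
  rcases hω.lt_or_gt with hneg | hpos
  · have := pencilDet_ne_zero_of_torus_of_ray (A₀ := A₀) (A := A) (s := -Complex.I) (by simp)
      (fun w hw ω hω => by simpa using h w hw (-ω) (by linarith)) hw (neg_pos.mpr hneg)
    simpa using this
  · exact pencilDet_ne_zero_of_torus_of_ray (by simp) (fun w hw ω hω => h w hw ω hω.ne') hw hpos

/-- Absence of nonzero imaginary roots on the closed polydisc forces a zero root inside the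
polydisc to persist along the complex line through the origin. -/
lemma pencilDet_zero_smul_eq_zero
    (h : ∀ w ∈ polydisc m, ∀ ω : ℝ, ω ≠ 0 → pencilDet A₀ A (Complex.I * ω) w ≠ 0)
    {w : Fin m → ℂ} (hw : w ∈ polydisc m) {r : ℂ} (hr : ‖r‖ < 1)
    (h0 : pencilDet A₀ A 0 (r • w) = 0) (t : ℂ) : pencilDet A₀ A 0 (t • w) = 0 := by
  by_contra ht
  have hdiff : ∀ z : ℂ, Differentiable ℂ fun t : ℂ => pencilDet A₀ A z (t • w) := fun z =>
    differentiable_pencilDet A₀ A (by fun_prop) fun k => by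
      simp only [Pi.smul_apply]
      fun_prop
  -- If not identically zero in `t`, the determinant still vanishes near `r`, inside the unit disc,
  -- for small `ω ≠ 0`.
  obtain ⟨U, hU, hzero⟩ := exists_nhds_forall_exists_zero
    (f := fun (ω : ℝ) (t : ℂ) => pencilDet A₀ A (Complex.I * ω) (t • w))
    (continuous_pencilDet A₀ A (by fun_prop) (by fun_prop)) (y₀ := 0) (hdiff _)
    (a := r) (by simpa using h0) (by simpa using ht) (sub_pos.mpr hr)
  obtain ⟨ω, hωU, hω⟩ := nonempty_of_mem (f := 𝓝[≠] (0 : ℝ))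
    (inter_mem (mem_nhdsWithin_of_mem_nhds hU) self_mem_nhdsWithin)
  obtain ⟨t, ht, htz⟩ := hzero (fun _ => ω) (fun _ _ => hωU) (hdiff _)
  refine h _ (smul_mem_polydisc hw ?_) ω hω htz
  rw [mem_closedBall, dist_eq_norm] at ht
  linarith [norm_le_norm_add_norm_sub r t, norm_sub_rev r t]

/-- If `A₀` is Hurwitz and there are no nonzero imaginary roots on the closed polydisc, then there
are no roots in the open right half-plane on the closed polydisc. -/
lemma re_nonpos_of_pencilDet_eq_zero (hA₀ : IsHurwitz A₀)
    (h : ∀ w ∈ polydisc m, ∀ ω : ℝ, ω ≠ 0 → pencilDet A₀ A (Complex.I * ω) w ≠ 0)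
    {w : Fin m → ℂ} (hw : w ∈ polydisc m) {z : ℂ} (hz : pencilDet A₀ A z w = 0) : z.re ≤ 0 := by
  by_contra! hre
  have hhur : ∀ z : ℂ, pencilDet A₀ A z 0 = 0 → z.re < 0 := fun z hz =>
    hA₀ z ((pencilDet_zero_right_eq_zero_iff A₀ A z).mp hz)
  obtain ⟨R, hR⟩ := exists_norm_le_of_pencilDet_eq_zero A₀ A
  have hsmul : ∀ r ∈ Icc (0 : ℝ) 1, (r : ℂ) • w ∈ polydisc m := fun r hr =>
    smul_mem_polydisc hw (by simpa [abs_of_nonneg hr.1] using hr.2)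
  -- Take the least scaling `r` of `w` admitting a root with `Re ≥ 0`.
  have hB : IsCompact ((Icc (0 : ℝ) 1 ×ˢ closedBall (0 : ℂ) R) ∩
      ({p : ℝ × ℂ | 0 ≤ p.2.re} ∩ {p : ℝ × ℂ | pencilDet A₀ A p.2 ((p.1 : ℂ) • w) = 0})) :=
    (isCompact_Icc.prod (isCompact_closedBall _ _)).inter_right
      ((isClosed_le continuous_const (by fun_prop)).inter
        (isClosed_eq (continuous_pencilDet A₀ A (by fun_prop) (by fun_prop)) continuous_const))
  obtain ⟨⟨r, z₁⟩, ⟨⟨hr, -⟩, hre₁, hz₁⟩, hmin⟩ := hB.exists_isMinOn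
    ⟨(1, z), ⟨⟨⟨zero_le_one, le_rfl⟩, by simpa using hR z w hw hz⟩, hre.le, by simpa using hz⟩⟩
    continuous_fst.continuousOn
  replace hre₁ : 0 ≤ z₁.re := hre₁
  replace hz₁ : pencilDet A₀ A z₁ ((r : ℂ) • w) = 0 := hz₁
  have hlt : ∀ r' ∈ Ico 0 r, ∀ z', 0 ≤ z'.re → pencilDet A₀ A z' ((r' : ℂ) • w) ≠ 0 := by
    intro r' hr' z' hre' hz'
    have hI : r' ∈ Icc (0 : ℝ) 1 := ⟨hr'.1, hr'.2.le.trans hr.2⟩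
    have : r ≤ r' := hmin (show (r', z') ∈ _ from
      ⟨⟨hI, by simpa using hR z' _ (hsmul r' hI) hz'⟩, hre', hz'⟩)
    linarith [hr'.2]
  have hr0 : 0 < r := by
    refine lt_of_le_of_ne hr.1 ?_
    rintro rfl
    exact absurd (hhur z₁ (by simpa using hz₁)) (not_lt.mpr hre₁)
  -- Near a root in the open right half-plane there are roots for smaller `r`.
  have hnotpos : ∀ z' : ℂ, 0 < z'.re → pencilDet A₀ A z' ((r : ℂ) • w) ≠ 0 := by
    intro z' hre' hz'
    obtain ⟨b, hb⟩ := exists_pencilDet_ne_zero A₀ A (hsmul r hr)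
    have hdiff : ∀ w', Differentiable ℂ fun z => pencilDet A₀ A z w' := fun w' =>
      differentiable_pencilDet A₀ A (by fun_prop) (by fun_prop)
    obtain ⟨U, hU, hzero⟩ := exists_nhds_forall_exists_zero
      (f := fun (r : ℝ) z => pencilDet A₀ A z ((r : ℂ) • w))
      (continuous_pencilDet A₀ A (by fun_prop) (by fun_prop)) (y₀ := r) (hdiff _) hz' hb hre'
    obtain ⟨r', hrU, hr'⟩ := nonempty_of_mem (f := 𝓝[<] r)
      (inter_mem (mem_nhdsWithin_of_mem_nhds hU) (Ico_mem_nhdsLT hr0))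
    obtain ⟨z'', hz'', hzz⟩ := hzero (fun _ => r') (fun _ _ => hrU) (hdiff _)
    refine hlt r' hr' z'' ?_ hzz
    rw [mem_closedBall, dist_eq_norm, norm_sub_rev] at hz''
    have := (Complex.re_le_norm (z' - z'')).trans hz''
    rw [Complex.sub_re] at this
    linarith
  have hr1 : r < 1 := by
    refine lt_of_le_of_ne hr.2 ?_
    rintro rfl
    exact hnotpos z hre (by simpa using hz)
  have hre0 : z₁.re = 0 := le_antisymm (not_lt.mp fun hp => hnotpos z₁ hp hz₁) hre₁
  have hz₁I : z₁ = Complex.I * z₁.im := by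
    apply Complex.ext <;> simp [hre0]
  -- A root at `0` with `r < 1` would persist down to scaling `0`, making `A₀` singular.
  by_cases him : z₁.im = 0
  · have hzero : z₁ = 0 := Complex.ext hre0 him
    rw [hzero] at hz₁
    have h0 := pencilDet_zero_smul_eq_zero h hw (r := (r : ℂ))
      (by simpa [abs_of_pos hr0] using hr1) hz₁ 0
    rw [zero_smul] at h0
    exact lt_irrefl _ (hhur 0 h0)
  · rw [hz₁I] at hz₁
    exact h _ (hsmul r hr) _ him hz₁

/-- Absolute stability forces the spectrum of `A₀` into the closed left half-plane. -/
lemma AbsolutelyStable.re_nonpos (h : AbsolutelyStable A₀ A) {z : ℂ}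
    (hz : z ∈ spectrum ℂ A₀) : z.re ≤ 0 := by
  by_contra! hre
  obtain ⟨b, hb⟩ := exists_pencilDet_ne_zero A₀ A (w := 0) (by simp [mem_polydisc])
  obtain ⟨U, hU, hzero⟩ := exists_nhds_forall_exists_zero
    (f := fun (w : Fin m → ℂ) z => pencilDet A₀ A z w)
    (continuous_pencilDet A₀ A (by fun_prop) (by fun_prop)) (y₀ := 0)
    (differentiable_pencilDet A₀ A (by fun_prop) (by fun_prop))
    ((pencilDet_zero_right_eq_zero_iff A₀ A z).mpr hz) hb (half_pos hre)
  obtain ⟨ε, hε, hεU⟩ := Metric.mem_nhds_iff.mp hU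
  -- One common large delay suffices: `Re ≥ z.re / 2` on the disc, so the exponentials are uniformly
  -- small there.
  have hdecay : Tendsto (fun τ : ℝ => Real.exp (-(z.re / 2 * τ))) atTop (𝓝 0) :=
    Real.tendsto_exp_neg_atTop_nhds_zero.comp
      (tendsto_id.const_mul_atTop (half_pos hre))
  obtain ⟨τ, hτε, hτ⟩ := ((hdecay.eventually_lt_const hε).and (eventually_ge_atTop 0)).exists
  have hhalf : ∀ z' ∈ closedBall z (z.re / 2), z.re / 2 ≤ z'.re := by
    intro z' hz'
    rw [mem_closedBall, dist_eq_norm, norm_sub_rev] at hz'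
    have := (Complex.re_le_norm (z - z')).trans hz'
    rw [Complex.sub_re] at this
    linarith
  obtain ⟨z', hz', hzz⟩ := hzero (fun z' _ => Complex.exp (-z' * τ))
    (fun z' hz' => hεU (by
      rw [mem_ball, dist_zero_right, pi_norm_lt_iff hε]
      intro _
      rw [Complex.norm_exp]
      refine lt_of_le_of_lt (Real.exp_le_exp.mpr ?_) hτε
      have := mul_le_mul_of_nonneg_right (hhalf z' hz') hτ
      simp
      linarith))
    (differentiable_pencilDet A₀ A (by fun_prop) (by fun_prop))
  have := h (fun _ => τ) (fun _ => hτ) z' hzz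
  linarith [hhalf z' hz']

/-! ### Phases, delays and the two criteria -/

lemma pencilDet_ne_zero_of_phaseMatrix
    (h : ∀ (Φ : Fin m → Real.Angle) (ω : ℝ), ω ≠ 0 →
      Complex.I * (ω : ℂ) ∉ spectrum ℂ (phaseMatrix A₀ A Φ))
    (w : Fin m → ℂ) (hw : ∀ k, ‖w k‖ = 1) (ω : ℝ) (hω : ω ≠ 0) :
    pencilDet A₀ A (Complex.I * ω) w ≠ 0 := by
  rw [Ne, pencilDet_eq_zero_iff]
  have hΦ := h (fun k => ((w k).arg : Real.Angle)) ω hω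
  have hc : ∀ k, (((w k).arg : Real.Angle).toCircle : ℂ) = w k := fun k => by
    rw [Real.Angle.toCircle_coe, Circle.coe_exp]
    simpa [hw k] using Complex.norm_mul_exp_arg_mul_I (w k)
  simpa only [phaseMatrix, hc] using hΦ

lemma isUnit_phaseMatrix_zero_iff :
    IsUnit (phaseMatrix A₀ A 0) ↔ pencilDet A₀ A 0 1 ≠ 0 := by
  rw [Ne, pencilDet_eq_zero_iff, spectrum.zero_mem_iff, not_not]
  simp [phaseMatrix]

/-- Every unit phase is realized by a nonnegative delay at a given nonzero frequency. -/
lemma exists_delay_exp_eq_toCircle (φ : Real.Angle) {ω : ℝ} (hω : ω ≠ 0) :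
    ∃ τ : ℝ, 0 ≤ τ ∧ Complex.exp (-(Complex.I * ω) * τ) = φ.toCircle := by
  have hφ : φ.toCircle = Circle.exp φ.toReal := by
    conv_lhs => rw [← φ.coe_toReal]
    exact Real.Angle.toCircle_coe _
  have hpos : 0 < |ω| := abs_pos.mpr hω
  -- `-φ / ω` gives the right phase; adding the period `2π / |ω|` makes it nonnegative, as `|φ| ≤
  -- π`.
  refine ⟨2 * Real.pi / |ω| - φ.toReal / ω, ?_, ?_⟩
  · have h1 : φ.toReal / ω ≤ Real.pi / |ω| := by
      refine (le_abs_self _).trans ?_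
      rw [abs_div]
      gcongr
      exact Real.Angle.abs_toReal_le_pi φ
    have h2 : Real.pi / |ω| ≤ 2 * Real.pi / |ω| := by
      gcongr
      linarith [Real.pi_pos]
    linarith
  · rw [hφ, Circle.coe_exp, Complex.exp_eq_exp_iff_exists_int]
    have hωc : (ω : ℂ) ≠ 0 := by exact_mod_cast hω
    rcases hω.lt_or_gt with hneg | hp
    · refine ⟨1, ?_⟩
      rw [abs_of_neg hneg]
      push_cast
      field_simp
      ring
    · refine ⟨-1, ?_⟩
      rw [abs_of_pos hp]
      push_cast
      field_simp
      ring

theorem absolutelyHyperbolic_iff :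
    AbsolutelyHyperbolic A₀ A ↔ IsUnit (phaseMatrix A₀ A 0) ∧
      ∀ (Φ : Fin m → Real.Angle) (ω : ℝ), ω ≠ 0 →
        Complex.I * (ω : ℂ) ∉ spectrum ℂ (phaseMatrix A₀ A Φ) := by
  constructor
  · intro h
    refine ⟨isUnit_phaseMatrix_zero_iff.mpr fun h0 => ?_, fun Φ ω hω hmem => ?_⟩
    · refine h 0 (fun _ => le_rfl) 0 ?_ rfl
      rw [charQuasipoly_eq_pencilDet, ← h0]
      congr
      simp
      rfl
    · choose τ hτ hexp using fun k => exists_delay_exp_eq_toCircle (Φ k) hω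
      refine h τ hτ (Complex.I * ω) ?_ (by simp)
      rw [charQuasipoly_eq_pencilDet, pencilDet_eq_zero_iff]
      simpa only [hexp] using! hmem
  · rintro ⟨h0, h⟩ τ - z hz hre
    rw [charQuasipoly_eq_pencilDet] at hz
    have hzI : z = Complex.I * z.im := by
      apply Complex.ext <;> simp [hre]
    by_cases him : z.im = 0
    · rw [show z = 0 from Complex.ext hre him] at hz
      refine isUnit_phaseMatrix_zero_iff.mp h0 (Eq.trans ?_ hz)
      congr
      simp
      rfl
    · rw [hzI] at hz
      refine pencilDet_ne_zero_of_phaseMatrix h _ (fun k => ?_) _ him hz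
      simp [Complex.norm_exp]

theorem absolutelyStable_iff :
    AbsolutelyStable A₀ A ↔ IsHurwitz A₀ ∧ IsUnit (phaseMatrix A₀ A 0) ∧
      ∀ (Φ : Fin m → Real.Angle) (ω : ℝ), ω ≠ 0 →
        Complex.I * (ω : ℂ) ∉ spectrum ℂ (phaseMatrix A₀ A Φ) := by
  rw [← absolutelyHyperbolic_iff]
  constructor
  · intro h
    have hyp : AbsolutelyHyperbolic A₀ A := fun τ hτ z hz => (h τ hτ z hz).ne
    refine ⟨fun z hz => lt_of_le_of_ne (h.re_nonpos hz) fun hre => ?_, hyp⟩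
    obtain ⟨h0, htorus⟩ := absolutelyHyperbolic_iff.mp hyp
    have hpoly : ∀ w ∈ polydisc m, ∀ ω : ℝ, ω ≠ 0 → pencilDet A₀ A (Complex.I * ω) w ≠ 0 :=
      fun w hw ω hω =>
        pencilDet_I_mul_ne_zero_of_torus (pencilDet_ne_zero_of_phaseMatrix htorus) hw hω
    rw [← pencilDet_zero_right_eq_zero_iff A₀ A] at hz
    have hzI : z = Complex.I * z.im := by
      apply Complex.ext <;> simp [hre]
    -- A zero eigenvalue of `A₀` would persist from `w = 0` to `w = 1`, making `S(0)` singular.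
    by_cases him : z.im = 0
    · rw [show z = 0 from Complex.ext hre him] at hz
      refine isUnit_phaseMatrix_zero_iff.mp h0 ?_
      simpa using pencilDet_zero_smul_eq_zero hpoly (w := 1) (r := 0) (by simp [mem_polydisc])
        (by simp) (by simpa using hz) 1
    · rw [hzI] at hz
      exact hpoly 0 (by simp [mem_polydisc]) _ him hz
  · rintro ⟨hA₀, hyp⟩ τ hτ z hz
    refine lt_of_le_of_ne (not_lt.mp fun hre => ?_) (hyp τ hτ z hz)
    have htorus := (absolutelyHyperbolic_iff.mp hyp).2
    refine not_le.mpr hre (re_nonpos_of_pencilDet_eq_zero hA₀ (fun w hw ω hω =>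
      pencilDet_I_mul_ne_zero_of_torus (pencilDet_ne_zero_of_phaseMatrix htorus) hw hω)
      (w := fun k => Complex.exp (-z * τ k)) ?_ hz)
    rw [mem_polydisc]
    intro k
    rw [Complex.norm_exp, Real.exp_le_one_iff]
    simpa using mul_nonneg hre.le (hτ k)

end DelaySystem

theorem mainTheorem1 {n m : ℕ} (A₀ : Matrix (Fin n) (Fin n) ℂ)
    (A : Fin m → Matrix (Fin n) (Fin n) ℂ) :
    (DelaySystem.AbsolutelyStable A₀ A ↔
      DelaySystem.IsHurwitz A₀ ∧
      IsUnit (DelaySystem.phaseMatrix A₀ A 0) ∧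
      ∀ (Φ : Fin m → Real.Angle) (ω : ℝ), ω ≠ 0 →
        Complex.I * (ω : ℂ) ∉ spectrum ℂ (DelaySystem.phaseMatrix A₀ A Φ)) ∧
    (DelaySystem.AbsolutelyHyperbolic A₀ A ↔
      IsUnit (DelaySystem.phaseMatrix A₀ A 0) ∧
      ∀ (Φ : Fin m → Real.Angle) (ω : ℝ), ω ≠ 0 →
        Complex.I * (ω : ℂ) ∉ spectrum ℂ (DelaySystem.phaseMatrix A₀ A Φ)) := by
  exact ⟨DelaySystem.absolutelyStable_iff, DelaySystem.absolutelyHyperbolic_iff⟩
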